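/- **Theorem 2.1.** For a partition $\pi$ and a positive integer $t$, label the cell in row $i$ and column $j$ of the Young diagram of $\pi$ by the least non-negative residue of $j-i$ modulo $t$, and let $r_j(\pi,t)$ be the number of cells labelled $j$ $(0\le j\le t-1)$. The GBG-rank of $\pi$ mod $t$ is $\mathrm{GBG}^{(t)}(\pi)=\sum_{j=0}^{t-1} r_j(\pi,t)\,\omega_t^{\,j}$ with $\omega_t=e^{2\pi i/t}$. The BG-rank of $\pi$ is $r_0(\pi,2)-r_1(\pi,2)$. Write $|\pi|$ for the sum of the parts and $l(\pi)$ for the largest part of $\pi$ (with $l=0$ for the empty partition). As formal power series in $q$, let $$G_{M,t}(k,q)=\sum_{\substack{\pi:\ l(\pi)\le M\\ \mathrm{GBG}^{(t)}(\pi)=k}} q^{|\pi|},\qquad \tilde B_M(k,q)=\sum_{\substack{\pi:\ l(\pi)\le M\\ \text{BG-rank}(\pi)=k}} q^{|\pi|}.$$ Put $(q^s;q^s)_L=\prod_{m=1}^{L}(1-q^{sm})$ for integers $L\ge 0$, with the convention $1/(q^s;q^s)_L=0$ for $L<0$. Let $N\ge 0$ be an integer and let $k$ be any integer. 1. For every prime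 $t$ and every $\nu\in\{0,1,\dots,t-1\}$, $$G_{tN+\nu,t}(k,q)=\frac{q^{tk^2-(t-1)k}}{(q^t;q^t)_{N+\lceil \nu/t\rceil-k}\;\Bigl(\prod_{i=1}^{t-2}(q^t;q^t)_{N+\lceil(\nu-i)/t\rceil}\Bigr)\;(q^t;q^t)_{N+k}}.$$ 2. (The Berkovich–Uncu formula, the case $t=2$.) For $\nu\in\{0,1\}$, $$\tilde B_{2N+\nu}(k,q)=\frac{q^{2k^2-k}}{(q^2;q^2)_{N+k}\,(q^2;q^2)_{N+\nu-k}}.$$ -/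

import Mathlib

open scoped PowerSeries

namespace GBG

noncomputable section

/-- The Young diagram of a partition: its rows, from the top, are the parts in weakly decreasing
order.  As in Mathlib, the cell `(i, j)` lies in row `i` and column `j`, counted from `0`. -/
def youngDiagram {n : ℕ} (p : n.Partition) : YoungDiagram :=
  YoungDiagram.ofRowLens (p.parts.sort (· ≥ ·)) (p.parts.pairwise_sort (· ≥ ·)).sortedGE

/-- `r_j(π, t)`: the number of cells of the `t`-residue diagram labelled `j`, where a cell in
row `i` and column `c` is labelled by the least non-negative residue of `c - i` modulo `t`
(the difference `c - i` is the same for rows and columns counted from `0` or from `1`). -/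
def residueCount {n : ℕ} (p : n.Partition) (t j : ℕ) : ℕ :=
  ((youngDiagram p).cells.filter fun c => ((c.2 : ℤ) - (c.1 : ℤ)) % (t : ℤ) = (j : ℤ)).card

/-- The GBG-rank of `π` mod `t`: `∑_{j < t} r_j(π, t) ω^j` with `ω = e^{2πi/t}`. -/
def gbgRank {n : ℕ} (p : n.Partition) (t : ℕ) : ℂ :=
  ∑ j ∈ Finset.range t,
    (residueCount p t j : ℂ) * Complex.exp (2 * Real.pi * Complex.I / (t : ℂ)) ^ j

/-- The BG-rank of `π`: `r_0 - r_1` in the `2`-residue diagram. -/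
def bgRank {n : ℕ} (p : n.Partition) : ℤ :=
  (residueCount p 2 0 : ℤ) - (residueCount p 2 1 : ℤ)

/-- The largest part `l(π)` (it is `0` for the empty partition). -/
def largestPart {n : ℕ} (p : n.Partition) : ℕ := p.parts.sup

/-- `G_{M,t}(k, q)`: the generating function, in the variable `X = q`, of the partitions with
largest part at most `M` and GBG-rank mod `t` equal to `k`. -/
def genGBG (M t : ℕ) (k : ℤ) : ℚ⟦X⟧ :=
  PowerSeries.mk fun n =>
    (Nat.card {p : n.Partition // gbgRank p t = (k : ℂ) ∧ largestPart p ≤ M} : ℚ)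

/-- The generating function of the partitions with largest part at most `M` and BG-rank `k`. -/
def genBG (M : ℕ) (k : ℤ) : ℚ⟦X⟧ :=
  PowerSeries.mk fun n =>
    (Nat.card {p : n.Partition // bgRank p = k ∧ largestPart p ≤ M} : ℚ)

/-- The finite `q`-Pochhammer symbol `(a; q)_L = ∏_{m < L} (1 - a q^m)`. -/
def qPochhammer (a q : ℚ⟦X⟧) (L : ℕ) : ℚ⟦X⟧ :=
  ∏ m ∈ Finset.range L, (1 - a * q ^ m)

/-- `1 / (X^s; X^s)_L` for an integer `L`, with the usual convention that it is `0` for `L < 0`.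
For `s ≥ 1` and `L ≥ 0` the symbol has constant term `1`, so this is a genuine inverse. -/
def recipPoch (s : ℕ) (L : ℤ) : ℚ⟦X⟧ :=
  if L < 0 then 0 else (qPochhammer (PowerSeries.X ^ s) (PowerSeries.X ^ s) L.toNat)⁻¹

/-- The exponent `t k² - (t - 1) k` is never negative, so `Int.toNat` does not truncate it. -/
theorem exponent_nonneg (t : ℕ) (ht : 1 ≤ t) (k : ℤ) :
    0 ≤ (t : ℤ) * k ^ 2 - ((t : ℤ) - 1) * k := by
  have h1 : (1 : ℤ) ≤ t := by exact_mod_cast ht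
  rcases le_or_gt k 0 with h | h
  · nlinarith [mul_nonneg (sub_nonneg.2 h1) (neg_nonneg.2 h), sq_nonneg k]
  · nlinarith [mul_nonneg (sub_nonneg.2 h1) (mul_nonneg h.le (sub_nonneg.2 (Int.add_one_le_iff.2 h))),
      sq_nonneg k]

end

end GBG

namespace GBG

theorem eq_of_sum_mul_primitiveRoot_eq_zero {t : ℕ} (ht : t.Prime) {ω : ℂ}
    (hω : IsPrimitiveRoot ω t) (a : ℕ → ℤ) (h : ∑ j ∈ Finset.range t, (a j : ℂ) * ω ^ j = 0)
    {j : ℕ} (hj : j < t) : a j = a (t - 1) := by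
  have hgeom : ∑ j ∈ Finset.range t, ω ^ j = 0 := hω.geom_sum_eq_zero ht.one_lt
  have h1 : ∑ j ∈ Finset.range t, ((a j - a (t - 1) : ℤ) : ℂ) * ω ^ j = 0 := by
    have : ∑ j ∈ Finset.range t, ((a j - a (t - 1) : ℤ) : ℂ) * ω ^ j
        = ∑ j ∈ Finset.range t, (a j : ℂ) * ω ^ j
          - (a (t - 1) : ℂ) * ∑ j ∈ Finset.range t, ω ^ j := by
      rw [Finset.mul_sum, ← Finset.sum_sub_distrib]
      exact Finset.sum_congr rfl fun j _ => by push_cast; ring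
    rw [this, h, hgeom, mul_zero, sub_zero]
  have hdeg : (minpoly ℚ ω).natDegree = t - 1 := by
    rw [← Polynomial.cyclotomic_eq_minpoly_rat hω ht.pos, Polynomial.natDegree_cyclotomic,
      Nat.totient_prime ht]
  have hli := linearIndependent_pow (K := ℚ) ω
  rw [hdeg] at hli
  rcases Nat.lt_or_ge j (t - 1) with hlt | hge
  · have := Fintype.linearIndependent_iff.1 hli (fun i => ((a i - a (t - 1) : ℤ) : ℚ)) ?_ ⟨j, hlt⟩
    · exact sub_eq_zero.1 (by exact_mod_cast this)
    · rw [← Nat.sub_add_cancel ht.one_lt.le, Finset.sum_range_succ] at h1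
      simp only [Nat.add_sub_cancel, sub_self, Int.cast_zero, zero_mul, add_zero] at h1
      rw [Fin.sum_univ_eq_sum_range (fun i => ((a i - a (t - 1) : ℤ) : ℚ) • ω ^ i), ← h1]
      exact Finset.sum_congr rfl fun i _ => by rw [Algebra.smul_def]; simp
  · rw [show j = t - 1 by omega]

/-- For prime `t` the only rational relation between the powers of `ω` is that they sum to zero, so
the GBG-rank is `k` exactly if `r_0 - k = r_1 = ⋯ = r_{t-1}`. -/
theorem gbgRank_eq_iff {n : ℕ} (p : n.Partition) {t : ℕ} (ht : t.Prime) (k : ℤ) :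
    gbgRank p t = (k : ℂ) ↔ (residueCount p t 0 : ℤ) - k = residueCount p t (t - 1) ∧
      ∀ j, 1 ≤ j → j < t → residueCount p t j = residueCount p t (t - 1) := by
  have hω := Complex.isPrimitiveRoot_exp t ht.ne_zero
  set ω := Complex.exp (2 * Real.pi * Complex.I / (t : ℂ)) with hωdef
  set a : ℕ → ℤ := fun j => (residueCount p t j : ℤ) - if j = 0 then k else 0 with ha
  have hsum : gbgRank p t - (k : ℂ) = ∑ j ∈ Finset.range t, (a j : ℂ) * ω ^ j := by
    have hk : (k : ℂ) = ∑ j ∈ Finset.range t, ((if j = 0 then k else 0 : ℤ) : ℂ) * ω ^ j := by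
      rw [Finset.sum_eq_single 0]
      · simp
      · intro b _ hb; simp [hb]
      · intro h; exact absurd (Finset.mem_range.2 ht.pos) h
    rw [gbgRank, hk, ← Finset.sum_sub_distrib]
    refine Finset.sum_congr rfl fun j _ => ?_
    simp only [ha]; push_cast; ring
  have h1 : t - 1 ≠ 0 := by have := ht.two_le; omega
  rw [← sub_eq_zero, hsum]
  constructor
  · intro h
    have key := fun j (hj : j < t) => eq_of_sum_mul_primitiveRoot_eq_zero ht hω a h hj
    refine ⟨?_, fun j hj hjt => ?_⟩
    · have := key 0 ht.pos
      simpa [ha, h1] using this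
    · have := key j hjt
      have hj0 : j ≠ 0 := by omega
      simpa [ha, h1, hj0] using this
  · rintro ⟨h0, hj⟩
    have hc : ∀ j ∈ Finset.range t, (a j : ℂ) * ω ^ j = (residueCount p t (t - 1) : ℂ) * ω ^ j := by
      intro j hjt
      rcases Nat.eq_zero_or_pos j with rfl | hpos
      · have : a 0 = (residueCount p t (t - 1) : ℤ) := by simpa [ha] using h0
        rw [this]; simp
      · have : a j = (residueCount p t (t - 1) : ℤ) := by
          simp [ha, hpos.ne', hj j hpos (Finset.mem_range.1 hjt)]
        rw [this]; simp
    rw [Finset.sum_congr rfl hc, ← Finset.mul_sum, hω.geom_sum_eq_zero ht.one_lt, mul_zero]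

theorem gbgRank_two_eq_iff {n : ℕ} (p : n.Partition) (k : ℤ) :
    gbgRank p 2 = (k : ℂ) ↔ bgRank p = k := by
  have h : (2 * Real.pi * Complex.I / ((2 : ℕ) : ℂ)) = Real.pi * Complex.I := by
    push_cast; ring
  rw [gbgRank, h, Complex.exp_pi_mul_I, Finset.sum_range_succ, Finset.sum_range_one, bgRank]
  rw [← Int.cast_inj (α := ℂ)]
  push_cast
  ring_nf

theorem rowLens_youngDiagram {n : ℕ} (p : n.Partition) :
    (youngDiagram p).rowLens = p.parts.sort (· ≥ ·) :=
  YoungDiagram.rowLens_ofRowLens_eq_self fun _ hx => p.parts_pos ((Multiset.mem_sort _).1 hx)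

theorem youngDiagram_injective {n : ℕ} :
    Function.Injective (youngDiagram : n.Partition → YoungDiagram) := by
  intro p q h
  have h1 := congrArg YoungDiagram.rowLens h
  rw [rowLens_youngDiagram, rowLens_youngDiagram] at h1
  apply Nat.Partition.ext
  rw [← Multiset.sort_eq p.parts (· ≥ ·), h1, Multiset.sort_eq]

theorem sum_rowLens (μ : YoungDiagram) : μ.rowLens.sum = μ.card := by
  have h : μ.card = ∑ i ∈ Finset.range (μ.colLen 0), (μ.row i).card := by
    refine Finset.card_eq_sum_card_fiberwise (f := Prod.fst) fun c hc => ?_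
    have : (c.1, c.2) ∈ μ := hc
    simp only [Finset.coe_range, Set.mem_Iio]
    exact (YoungDiagram.mem_iff_lt_colLen.1 this).trans_le (μ.colLen_anti _ _ (Nat.zero_le _))
  rw [h, YoungDiagram.rowLens]
  refine Eq.trans (b := ∑ i ∈ Finset.range (μ.colLen 0), μ.rowLen i) rfl ?_
  exact Finset.sum_congr rfl fun i _ => μ.rowLen_eq_card

theorem card_youngDiagram {n : ℕ} (p : n.Partition) : (youngDiagram p).card = n := by
  rw [← sum_rowLens, rowLens_youngDiagram, ← Multiset.sum_coe, Multiset.sort_eq, p.parts_sum]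

theorem exists_youngDiagram_eq (μ : YoungDiagram) :
    ∃ p : μ.card.Partition, youngDiagram p = μ := by
  refine ⟨⟨μ.rowLens, fun {i} hi => μ.pos_of_mem_rowLens i hi, by
    rw [Multiset.sum_coe, sum_rowLens]⟩, ?_⟩
  apply YoungDiagram.equivListRowLens.injective
  apply Subtype.ext
  change YoungDiagram.rowLens _ = YoungDiagram.rowLens _
  rw [rowLens_youngDiagram]
  exact List.mergeSort_eq_self _ μ.rowLens_sorted.pairwise

theorem largestPart_le_iff {n : ℕ} (p : n.Partition) (M : ℕ) :
    largestPart p ≤ M ↔ (youngDiagram p).colLen M = 0 := by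
  have h0 : (youngDiagram p).colLen M = 0 ↔ ∀ i, (i, M) ∉ youngDiagram p := by
    simp only [YoungDiagram.mem_iff_lt_colLen, not_lt]
    exact ⟨fun h i => h ▸ Nat.zero_le i, fun h => Nat.le_zero.1 (h 0)⟩
  rw [h0, largestPart, Multiset.sup_le]
  constructor
  · intro h i hi
    obtain ⟨hi1, hi2⟩ := YoungDiagram.mem_ofRowLens.1 hi
    exact absurd hi2 (not_lt.2 (h _ ((Multiset.mem_sort (· ≥ ·)).1 (List.getElem_mem hi1))))
  · intro h b hb
    by_contra hlt
    obtain ⟨i, hi, rfl⟩ := List.getElem_of_mem ((Multiset.mem_sort (· ≥ ·)).2 hb)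
    exact h i (YoungDiagram.mem_ofRowLens.2 ⟨hi, not_le.1 hlt⟩)

/-- Counting the cells of a diagram with at most `M` columns column by column. -/
theorem card_filter_cells {μ : YoungDiagram} {M : ℕ} (hM : μ.colLen M = 0)
    (P : ℕ × ℕ → Prop) [DecidablePred P] :
    (μ.cells.filter P).card =
      ∑ j ∈ Finset.range M, ((Finset.range (μ.colLen j)).filter fun i => P (i, j)).card := by
  have hmaps : ∀ c ∈ μ.cells.filter P, c.2 ∈ Finset.range M := by
    intro c hc
    have hc' : (c.1, c.2) ∈ μ := (Finset.mem_filter.1 hc).1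
    rw [Finset.mem_range]
    by_contra hlt
    have := μ.colLen_anti _ _ (not_lt.1 hlt)
    have := YoungDiagram.mem_iff_lt_colLen.1 hc'
    omega
  rw [Finset.card_eq_sum_card_fiberwise hmaps]
  refine Finset.sum_congr rfl fun j _ => ?_
  refine .trans ?_ (Finset.card_map ⟨fun i : ℕ => (i, j), fun a b h => congrArg Prod.fst h⟩)
  refine congrArg Finset.card (Finset.ext fun ⟨i, j'⟩ => ?_)
  simp only [Finset.mem_filter, YoungDiagram.mem_cells, Finset.mem_map, Finset.mem_range]
  constructor
  · rintro ⟨⟨h1, h2⟩, rfl⟩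
    exact ⟨i, ⟨YoungDiagram.mem_iff_lt_colLen.1 h1, h2⟩, rfl⟩
  · rintro ⟨a, ⟨h1, h2⟩, ⟨⟩⟩
    exact ⟨⟨YoungDiagram.mem_iff_lt_colLen.2 h1, h2⟩, rfl⟩

/-- The contents of the cells of a column of height `h` telescope. -/
theorem card_column_residue_sub (t : ℕ) (j c : ℤ) (h : ℕ) :
    (((Finset.range h).filter fun i : ℕ => j - i ≡ c [ZMOD t]).card : ℤ) -
      ((Finset.range h).filter fun i : ℕ => j - i ≡ c + 1 [ZMOD t]).card =
      (if j ≡ c [ZMOD t] then 1 else 0) - (if j - h ≡ c [ZMOD t] then 1 else 0) := by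
  induction h with
  | zero => simp
  | succ h ih =>
    have e : (j - ((h + 1 : ℕ) : ℤ) ≡ c [ZMOD t]) ↔ (j - h ≡ c + 1 [ZMOD t]) := by
      rw [show j - (h : ℤ) = j - ((h + 1 : ℕ) : ℤ) + 1 by push_cast; ring]
      exact ⟨fun hh => hh.add_right 1, fun hh => hh.add_right_cancel' 1⟩
    simp only [e]
    rw [Finset.range_add_one, Finset.filter_insert, Finset.filter_insert]
    split_ifs at ih ⊢ <;> simp [Finset.card_insert_of_notMem] at ih ⊢ <;> omega

/-- The first-column (beta) numbers of the conjugate of a diagram with at most `M` columns. -/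
def betaSet (M : ℕ) (μ : YoungDiagram) : Finset ℕ :=
  (Finset.range M).image fun i => μ.colLen (M - 1 - i) + i

theorem strictMono_beta (M : ℕ) (μ : YoungDiagram) :
    StrictMono fun i => μ.colLen (M - 1 - i) + i := by
  intro a b hab
  have := μ.colLen_anti (M - 1 - b) (M - 1 - a) (by omega)
  simp only
  omega

theorem card_betaSet (M : ℕ) (μ : YoungDiagram) : (betaSet M μ).card = M := by
  rw [betaSet, Finset.card_image_of_injective _ (strictMono_beta M μ).injective, Finset.card_range]

theorem sum_betaSet_apply {A : Type*} [AddCommMonoid A] (M : ℕ) (μ : YoungDiagram) (f : ℕ → A) :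
    ∑ b ∈ betaSet M μ, f b = ∑ j ∈ Finset.range M, f (μ.colLen j + (M - 1 - j)) := by
  rw [betaSet, Finset.sum_image fun a _ b _ h => (strictMono_beta M μ).injective h,
    ← Finset.sum_range_reflect]
  refine Finset.sum_congr rfl fun j hj => ?_
  have := Finset.mem_range.1 hj
  rw [show M - 1 - (M - 1 - j) = j by omega]

theorem sum_betaSet {M : ℕ} {μ : YoungDiagram} (hM : μ.colLen M = 0) :
    ∑ b ∈ betaSet M μ, b = μ.card + ∑ i ∈ Finset.range M, i := by
  have h := card_filter_cells hM fun _ => True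
  simp only [Finset.filter_true, Finset.card_range] at h
  rw [sum_betaSet_apply, Finset.sum_add_distrib, Finset.sum_range_reflect (fun i => i), ← h]

theorem betaSet_injOn (M : ℕ) : Set.InjOn (betaSet M) {μ | μ.colLen M = 0} := by
  intro μ hμ ν hν h
  have hmono := fun μ : YoungDiagram => (strictMono_beta M μ).comp (Fin.val_strictMono (n := M))
  have hrange : ∀ μ : YoungDiagram,
      Set.range ((fun i => μ.colLen (M - 1 - i) + i) ∘ (Fin.val : Fin M → ℕ)) = betaSet M μ := by
    intro μ
    rw [Set.range_comp, Fin.range_val, betaSet, Finset.coe_image]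
    congr 1
    ext; simp
  have heq := ((hmono μ).range_inj (hmono ν)).1 (by rw [hrange, hrange, h])
  have hcol : ∀ j, μ.colLen j = ν.colLen j := by
    intro j
    rcases Nat.lt_or_ge j M with hj | hj
    · have := congrFun heq ⟨M - 1 - j, by omega⟩
      simp only [Function.comp] at this
      rw [show M - 1 - (M - 1 - j) = j by omega] at this
      omega
    · have h1 := μ.colLen_anti _ _ hj
      have h2 := ν.colLen_anti _ _ hj
      simp only [Set.mem_ofPred_eq] at hμ hν
      omega
  ext ⟨i, j⟩
  rw [YoungDiagram.mem_cells, YoungDiagram.mem_cells, YoungDiagram.mem_iff_lt_colLen,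
    YoungDiagram.mem_iff_lt_colLen, hcol]

theorem exists_betaSet_eq (S : Finset ℕ) :
    ∃ μ : YoungDiagram, μ.colLen S.card = 0 ∧ betaSet S.card μ = S := by
  obtain ⟨M, hM⟩ : ∃ M, S.card = M := ⟨_, rfl⟩
  rw [hM]
  set f := S.orderEmbOfFin hM with hf
  have hgap : ∀ a b : ℕ, ∀ (ha : a < M) (hb : b < M), a ≤ b → f ⟨a, ha⟩ + (b - a) ≤ f ⟨b, hb⟩ := by
    intro a b ha hb hab
    induction b, hab using Nat.le_induction with
    | base => simp
    | succ b hab ih =>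
      have h1 := ih (by omega)
      have h2 : f ⟨b, by omega⟩ < f ⟨b + 1, hb⟩ := f.strictMono (by simp)
      omega
  have hid : ∀ a : ℕ, ∀ ha : a < M, a ≤ f ⟨a, ha⟩ := by
    intro a ha
    have := hgap 0 a (by omega) ha (Nat.zero_le _)
    omega
  let h : ℕ → ℕ := fun j => if hj : j < M then f ⟨M - 1 - j, by omega⟩ - (M - 1 - j) else 0
  have hanti : ∀ a b, a ≤ b → h b ≤ h a := by
    intro a b hab
    simp only [h]
    split_ifs with hb ha
    · have h1 := hgap (M - 1 - b) (M - 1 - a) (by omega) (by omega) (by omega)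
      have h2 := hid (M - 1 - b) (by omega)
      omega
    · omega
    all_goals exact Nat.zero_le _
  let μ : YoungDiagram :=
    { cells := (Finset.range (h 0) ×ˢ Finset.range M).filter fun c => c.1 < h c.2
      isLowerSet := by
        rintro ⟨i2, j2⟩ ⟨i1, j1⟩ ⟨hi : i1 ≤ i2, hj : j1 ≤ j2⟩ hcell
        simp only [Finset.coe_filter, Finset.mem_product, Finset.mem_range,
          Set.mem_ofPred_eq] at hcell ⊢
        have := hanti _ _ hj
        omega }
  have hcol : ∀ j, μ.colLen j = h j := by
    intro j
    have : ∀ i, i < μ.colLen j ↔ i < h j := by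
      intro i
      rw [← YoungDiagram.mem_iff_lt_colLen]
      change (i, j) ∈ (Finset.range (h 0) ×ˢ Finset.range M).filter (fun c => c.1 < h c.2) ↔ _
      simp only [Finset.mem_filter, Finset.mem_product, Finset.mem_range]
      refine ⟨fun hh => hh.2, fun hh => ⟨⟨hh.trans_le (hanti _ _ (Nat.zero_le _)), ?_⟩, hh⟩⟩
      by_contra hj
      simp [h, hj] at hh
    exact le_antisymm (not_lt.1 fun hlt => lt_irrefl _ ((this _).1 hlt))
      (not_lt.1 fun hlt => lt_irrefl _ ((this _).2 hlt))
  refine ⟨μ, by rw [hcol]; simp [h], ?_⟩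
  refine Finset.eq_of_subset_of_card_le ?_ (by rw [card_betaSet, hM])
  intro b hb
  obtain ⟨i, hi, rfl⟩ := Finset.mem_image.1 hb
  have hi := Finset.mem_range.1 hi
  have : μ.colLen (M - 1 - i) + i = f ⟨i, hi⟩ := by
    rw [hcol]
    simp only [h, show M - 1 - i < M by omega, dite_true, show M - 1 - (M - 1 - i) = i by omega]
    have := hid i hi
    omega
  simp only [this]
  exact S.orderEmbOfFin_mem hM _

/-- The differences of the residue counts of a diagram with at most `M` columns, in terms of the
number of its beta numbers in a residue class. -/
theorem card_residue_sub {M : ℕ} {μ : YoungDiagram} (hM : μ.colLen M = 0) (t : ℕ) (c : ℤ) :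
    ((μ.cells.filter fun x : ℕ × ℕ => (x.2 : ℤ) - x.1 ≡ c [ZMOD t]).card : ℤ) -
      (μ.cells.filter fun x : ℕ × ℕ => (x.2 : ℤ) - x.1 ≡ c + 1 [ZMOD t]).card =
      ((Finset.range M).filter fun j : ℕ => (j : ℤ) ≡ c [ZMOD t]).card -
        ((betaSet M μ).filter fun b : ℕ => (M : ℤ) - 1 - b ≡ c [ZMOD t]).card := by
  rw [card_filter_cells hM, card_filter_cells hM, Finset.card_filter, Finset.card_filter,
    sum_betaSet_apply]
  push_cast
  rw [← Finset.sum_sub_distrib, ← Finset.sum_sub_distrib]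
  refine Finset.sum_congr rfl fun j hj => ?_
  have := Finset.mem_range.1 hj
  have h := card_column_residue_sub t j c (μ.colLen j)
  push_cast [Nat.cast_sub (show j ≤ M - 1 by omega), Nat.cast_sub (show 1 ≤ M by omega)]
  rw [h, show (M : ℤ) - 1 - (μ.colLen j + (M - 1 - j)) = j - μ.colLen j by ring]

theorem residueCount_eq {n : ℕ} (p : n.Partition) {t j : ℕ} (hj : j < t) :
    residueCount p t j =
      ((youngDiagram p).cells.filter fun x : ℕ × ℕ => (x.2 : ℤ) - x.1 ≡ j [ZMOD t]).card := by
  have : (j : ℤ) % t = j := Int.emod_eq_of_lt (by omega) (by omega)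
  simp only [residueCount, Int.ModEq, this]

/-- The generating function of a weight function. -/
noncomputable def weightGF {α : Type*} (w : α → ℕ) : ℚ⟦X⟧ :=
  PowerSeries.mk fun n => (Nat.card {a // w a = n} : ℚ)

theorem coeff_weightGF {α : Type*} (w : α → ℕ) (n : ℕ) :
    PowerSeries.coeff n (weightGF w) = (Nat.card {a // w a = n} : ℚ) :=
  PowerSeries.coeff_mk _ _

theorem weightGF_congr {α β : Type*} (e : α ≃ β) {w : α → ℕ} {v : β → ℕ}
    (h : ∀ a, v (e a) = w a) : weightGF w = weightGF v := by
  ext n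
  rw [coeff_weightGF, coeff_weightGF]
  exact congrArg _ (Nat.card_congr (e.subtypeEquiv fun a => by rw [h]))

theorem weightGF_add_const {α : Type*} (w : α → ℕ) (m : ℕ) :
    weightGF (fun a => w a + m) = weightGF w * PowerSeries.X ^ m := by
  ext n
  rw [coeff_weightGF, PowerSeries.coeff_mul_X_pow']
  split_ifs with h
  · rw [coeff_weightGF]
    exact congrArg _ (Nat.card_congr (Equiv.subtypeEquivRight fun a => by omega))
  · have : IsEmpty {a // w a + m = n} := ⟨fun a => h (by have := a.2; omega)⟩
    simp

theorem weightGF_sum {α β : Type*} (w : α → ℕ) (v : β → ℕ) (hw : ∀ n, Finite {a // w a = n})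
    (hv : ∀ n, Finite {b // v b = n}) :
    weightGF (Sum.elim w v) = weightGF w + weightGF v := by
  ext n
  rw [map_add, coeff_weightGF, coeff_weightGF, coeff_weightGF, ← Nat.cast_add, ← Nat.card_sum]
  exact congrArg _ (Nat.card_congr (Equiv.subtypeSum (p := fun c => Sum.elim w v c = n)))

theorem weightGF_pi {ι : Type*} [Fintype ι] {α : ι → Type*} (w : ∀ i, α i → ℕ)
    (hw : ∀ i n, Finite {a // w i a = n}) :
    weightGF (fun a : ∀ i, α i => ∑ i, w i (a i)) = ∏ i, weightGF (w i) := by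
  classical
  ext n
  rw [PowerSeries.coeff_prod, coeff_weightGF]
  simp only [coeff_weightGF]
  let f : {a : ∀ i, α i // ∑ i, w i (a i) = n} →
      Finset.finsuppAntidiag (Finset.univ : Finset ι) n := fun a =>
    ⟨Finsupp.equivFunOnFinite.symm fun i => w i (a.1 i), by
      rw [Finset.mem_finsuppAntidiag]; exact ⟨a.2, Finset.subset_univ _⟩⟩
  have e : {a : ∀ i, α i // ∑ i, w i (a i) = n} ≃
      Σ l : Finset.finsuppAntidiag (Finset.univ : Finset ι) n, ∀ i, {a // w i a = l.1 i} :=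
    (Equiv.sigmaFiberEquiv f).symm.trans <| Equiv.sigmaCongrRight fun l =>
      { toFun := fun a i => ⟨a.1.1 i, congrArg (fun l => l.1 i) a.2⟩
        invFun := fun x => ⟨⟨fun i => (x i).1, by
          refine (Finset.sum_congr rfl fun i _ => (x i).2).trans ?_
          exact (Finset.mem_finsuppAntidiag.1 l.2).1⟩,
          Subtype.ext (Finsupp.ext fun i => (x i).2)⟩
        left_inv := fun a => rfl
        right_inv := fun x => rfl }
  rw [Nat.card_congr e, Nat.card_sigma]
  simp only [Nat.card_pi]
  push_cast
  rw [Finset.sum_coe_sort (Finset.finsuppAntidiag (Finset.univ : Finset ι) n)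
    fun l => ∏ i, (Nat.card {a // w i a = l i} : ℚ)]

/-- Finite sets of natural numbers with `m + 1` elements: either `0` is not an element, and all
elements can be decreased by `1`, or it is, and it can be removed first. -/
def finsetShift (m : ℕ) :
    {T : Finset ℕ // T.card = m + 1} ⊕ {T : Finset ℕ // T.card = m} →
      {T : Finset ℕ // T.card = m + 1} :=
  Sum.elim (fun T => ⟨T.1.map (addRightEmbedding 1), by rw [Finset.card_map, T.2]⟩)
    fun T => ⟨insert 0 (T.1.map (addRightEmbedding 1)), by
      rw [Finset.card_insert_of_notMem (by simp), Finset.card_map, T.2]⟩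

theorem finsetShift_bijective (m : ℕ) : Function.Bijective (finsetShift m) := by
  have h0 : ∀ T : Finset ℕ, 0 ∉ T.map (addRightEmbedding 1) := by simp
  have hmap : ∀ T : Finset ℕ, ((T.erase 0).image (· - 1)).map (addRightEmbedding 1) = T.erase 0 := by
    intro T
    ext b
    simp only [Finset.mem_map, Finset.mem_image, addRightEmbedding_apply]
    constructor
    · rintro ⟨_, ⟨c, hc, rfl⟩, rfl⟩
      have := Finset.ne_of_mem_erase hc
      rwa [Nat.sub_add_cancel (by omega)]
    · intro hb
      have := Finset.ne_of_mem_erase hb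
      exact ⟨b - 1, ⟨b, hb, rfl⟩, by omega⟩
  have hcard : ∀ T : Finset ℕ, ((T.erase 0).image (· - 1)).card = (T.erase 0).card := by
    intro T
    rw [← Finset.card_map (addRightEmbedding 1), hmap]
  constructor
  · rintro (S | S) (T | T) h
    · exact congrArg Sum.inl (Subtype.ext (Finset.map_injective _ (congrArg Subtype.val h)))
    · have h1 : S.1.map (addRightEmbedding 1) = insert 0 (T.1.map (addRightEmbedding 1)) :=
        congrArg Subtype.val h
      exact absurd (h1 ▸ Finset.mem_insert_self _ _) (h0 S.1)
    · have h1 : insert 0 (S.1.map (addRightEmbedding 1)) = T.1.map (addRightEmbedding 1) :=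
        congrArg Subtype.val h
      exact absurd (h1 ▸ Finset.mem_insert_self _ _) (h0 T.1)
    · have h1 : insert 0 (S.1.map (addRightEmbedding 1)) =
          insert 0 (T.1.map (addRightEmbedding 1)) := congrArg Subtype.val h
      have h2 := congrArg (fun A => A.erase 0) h1
      simp only [Finset.erase_insert (h0 _)] at h2
      exact congrArg Sum.inr (Subtype.ext (Finset.map_injective _ h2))
  · intro T
    by_cases hT : 0 ∈ T.1
    · refine ⟨Sum.inr ⟨(T.1.erase 0).image (· - 1), ?_⟩, Subtype.ext ?_⟩
      · rw [hcard, Finset.card_erase_of_mem hT, T.2, Nat.add_sub_cancel]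
      · change insert 0 (Finset.map _ _) = _
        rw [hmap, Finset.insert_erase hT]
    · refine ⟨Sum.inl ⟨(T.1.erase 0).image (· - 1), ?_⟩, Subtype.ext ?_⟩
      · rw [hcard, Finset.erase_eq_of_notMem hT, T.2]
      · change Finset.map _ _ = _
        rw [hmap, Finset.erase_eq_of_notMem hT]

theorem finite_finset_weight {t : ℕ} (ht : 0 < t) (m n : ℕ) :
    Finite {T : {T : Finset ℕ // T.card = m} // t * ∑ b ∈ T.1, b = n} := by
  refine Finite.of_injective (β := (Finset.range (n + 1)).powerset) (fun T => ⟨T.1.1, ?_⟩) ?_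
  · rw [Finset.mem_powerset]
    intro b hb
    have h1 : b ≤ ∑ b ∈ T.1.1, b := Finset.single_le_sum (f := fun b => b) (by simp) hb
    have h2 := Nat.le_mul_of_pos_left (∑ b ∈ T.1.1, b) ht
    have := T.2
    rw [Finset.mem_range]
    omega
  · intro S T h
    exact Subtype.ext (Subtype.ext (congrArg (fun x => x.1) h))

theorem weightGF_finset {t : ℕ} (ht : 0 < t) (m : ℕ) :
    weightGF (fun T : {T : Finset ℕ // T.card = m} => t * ∑ b ∈ T.1, b) =
      PowerSeries.X ^ (t * ∑ i ∈ Finset.range m, i) * recipPoch t m := by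
  have hcc : ∀ m, PowerSeries.constantCoeff
      (qPochhammer (PowerSeries.X ^ t) (PowerSeries.X ^ t) m) ≠ 0 := by
    intro m
    simp [qPochhammer, map_prod, ht.ne']
  have hrec : ∀ m : ℕ, recipPoch t m =
      (qPochhammer (PowerSeries.X ^ t) (PowerSeries.X ^ t) m)⁻¹ := by
    intro m; simp [recipPoch]
  rw [hrec, PowerSeries.eq_mul_inv_iff_mul_eq (hcc m)]
  induction m with
  | zero =>
    simp only [qPochhammer, Finset.range_zero, Finset.prod_empty, mul_one, Finset.sum_empty,
      mul_zero, pow_zero]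
    ext n
    rw [coeff_weightGF, PowerSeries.coeff_one]
    split_ifs with h
    · subst h
      have : Unique {T : {T : Finset ℕ // T.card = 0} // t * ∑ b ∈ T.1, b = 0} :=
        { default := ⟨⟨∅, rfl⟩, by simp⟩
          uniq := fun T => Subtype.ext (Subtype.ext (Finset.card_eq_zero.1 T.1.2)) }
      rw [Nat.card_unique, Nat.cast_one]
    · have : IsEmpty {T : {T : Finset ℕ // T.card = 0} // t * ∑ b ∈ T.1, b = n} :=
        ⟨fun T => h (by rw [← T.2, Finset.card_eq_zero.1 T.1.2]; simp)⟩
      simp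
  | succ m ih =>
    have hrecur := weightGF_congr (Equiv.ofBijective _ (finsetShift_bijective m))
      (w := Sum.elim (fun T => t * ∑ b ∈ T.1, b + t * (m + 1)) fun T => t * ∑ b ∈ T.1, b + t * m)
      (v := fun T => t * ∑ b ∈ T.1, b) (by
        rintro (T | T)
        · simp [finsetShift, Finset.sum_add_distrib, T.2, mul_add]
        · simp [finsetShift, Finset.sum_add_distrib, T.2, mul_add])
    rw [weightGF_sum _ _ _ _, weightGF_add_const, weightGF_add_const] at hrecur
    · rw [qPochhammer, Finset.prod_range_succ, ← qPochhammer, Finset.sum_range_succ, mul_add,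
        pow_add, ← ih]
      have e : (1 - PowerSeries.X ^ t * (PowerSeries.X ^ t) ^ m : ℚ⟦X⟧)
          = 1 - PowerSeries.X ^ (t * (m + 1)) := by ring
      rw [e]
      linear_combination (- qPochhammer (PowerSeries.X ^ t) (PowerSeries.X ^ t) m) * hrecur
    · intro n
      have := finite_finset_weight ht (m + 1) (n - t * (m + 1))
      exact Finite.of_injective (fun T => (⟨T.1, by have := T.2; omega⟩ :
        {T : {T : Finset ℕ // T.card = m + 1} // t * ∑ b ∈ T.1, b = n - t * (m + 1)}))
        fun S T h => Subtype.ext (congrArg (fun x => x.1) h)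
    · intro n
      have := finite_finset_weight ht m (n - t * m)
      exact Finite.of_injective (fun T => (⟨T.1, by have := T.2; omega⟩ :
        {T : {T : Finset ℕ // T.card = m} // t * ∑ b ∈ T.1, b = n - t * m}))
        fun S T h => Subtype.ext (congrArg (fun x => x.1) h)

theorem residueCount_sub {n : ℕ} (p : n.Partition) {M : ℕ} (hM : largestPart p ≤ M) {t c d : ℕ}
    (hc : c < t) (hd : d < t) (hcd : (d : ℤ) ≡ c + 1 [ZMOD t]) :
    (residueCount p t c : ℤ) - residueCount p t d =
      ((Finset.range M).filter fun j : ℕ => (j : ℤ) ≡ c [ZMOD t]).card -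
        ((betaSet M (youngDiagram p)).filter fun b : ℕ => (M : ℤ) - 1 - b ≡ c [ZMOD t]).card := by
  rw [residueCount_eq p hc, residueCount_eq p hd,
    ← card_residue_sub ((largestPart_le_iff p M).1 hM)]
  congr 3
  ext x
  simp only [Finset.mem_filter]
  exact and_congr_right fun _ => ⟨fun h => h.trans hcd, fun h => h.trans hcd.symm⟩

/-- The number of beads with position in `{0, …, t N + ν - 1}` in the residue class `c < t`. -/
def baseSize (N ν c : ℕ) : ℕ := if c < ν then N + 1 else N

theorem card_range_filter_modEq {t ν c : ℕ} (N : ℕ) (hν : ν < t) (hc : c < t) :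
    ((Finset.range (t * N + ν)).filter fun j : ℕ => (j : ℤ) ≡ c [ZMOD t]).card =
      baseSize N ν c := by
  have h := Nat.count_modEq_card (t * N + ν) (Nat.zero_lt_of_lt hc) c
  rw [Nat.count_eq_card_filter_range] at h
  simp only [Int.natCast_modEq_iff, h, baseSize, Nat.mul_add_mod, Nat.mod_eq_of_lt hν,
    Nat.mod_eq_of_lt hc]
  rw [Nat.mul_add_div (Nat.zero_lt_of_lt hc), Nat.div_eq_of_lt hν]
  split_ifs <;> rfl

/-- The number of beads on the runner `c` for the partitions of GBG-rank `k`. -/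
def runnerSize (t N ν : ℕ) (k : ℤ) (c : ℕ) : ℤ :=
  baseSize N ν c + ((if c = t - 1 then k else 0) - if c = 0 then k else 0)

/-- The first position on the runner `c`. -/
def runnerStart (t ν c : ℕ) : ℕ := if c < ν then ν - 1 - c else ν + t - 1 - c

theorem gbgRank_eq_iff_card_filter_betaSet {n : ℕ} (p : n.Partition) {t ν : ℕ} (N : ℕ)
    (ht : t.Prime) (hν : ν < t) (k : ℤ) (hM : largestPart p ≤ t * N + ν) :
    gbgRank p t = (k : ℂ) ↔ ∀ c < t,
      (((betaSet (t * N + ν) (youngDiagram p)).filter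
        fun b : ℕ => ((t * N + ν : ℕ) : ℤ) - 1 - b ≡ c [ZMOD t]).card : ℤ) =
      runnerSize t N ν k c := by
  have h2 := ht.two_le
  have hstep : ∀ c, c + 1 < t → _ := fun c hc =>
    residueCount_sub p hM (t := t) (c := c) (d := c + 1) (by omega) hc (by push_cast; rfl)
  have hlast := residueCount_sub p hM (t := t) (c := t - 1) (d := 0) (by omega) (by omega)
    (by rw [Nat.cast_sub (by omega)]; simp [Int.ModEq])
  rw [gbgRank_eq_iff p ht]
  have hsize : ∀ c < t, _ := fun c hc => card_range_filter_modEq (t := t) (c := c) N hν hc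
  constructor
  · rintro ⟨h0, hj⟩ c hc
    rcases Nat.lt_or_ge (c + 1) t with hc1 | hc1
    · have h1 := hstep c hc1
      rw [hsize c hc, hj (c + 1) (by omega) hc1] at h1
      rw [runnerSize, if_neg (by omega)]
      split_ifs with hc0
      · subst hc0; omega
      · have := hj c (by omega) hc; omega
    · obtain rfl : c = t - 1 := by omega
      rw [hsize _ hc] at hlast
      rw [runnerSize, if_pos rfl, if_neg (by omega)]
      omega
  · intro h
    have hlast' := h (t - 1) (by omega)
    rw [runnerSize, if_pos rfl, if_neg (by omega)] at hlast'
    rw [hsize _ (by omega)] at hlast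
    refine ⟨by omega, fun j hj1 hjt => ?_⟩
    have key : ∀ i, i ≤ t - 2 → residueCount p t (t - 1 - i) = residueCount p t (t - 1) := by
      intro i hi
      induction i with
      | zero => rfl
      | succ i ih =>
        have h1 := hstep (t - 1 - (i + 1)) (by omega)
        rw [hsize _ (by omega), h _ (by omega), runnerSize, if_neg (by omega), if_neg (by omega),
          show t - 1 - (i + 1) + 1 = t - 1 - i by omega, ih (by omega)] at h1
        omega
    rw [← key (t - 1 - j) (by omega)]
    congr 1
    omega

theorem modEq_runnerStart_add (t ν N : ℕ) {c : ℕ} (hν : ν < t) (hc : c < t) (a : ℕ) :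
    ((t * N + ν : ℕ) : ℤ) - 1 - ((t * a + runnerStart t ν c : ℕ) : ℤ) ≡ c [ZMOD t] := by
  rw [Int.modEq_iff_dvd, runnerStart]
  split_ifs with h
  · refine ⟨a - N, ?_⟩
    push_cast [Nat.cast_sub (show c ≤ ν - 1 by omega), Nat.cast_sub (show 1 ≤ ν by omega)]
    ring
  · refine ⟨a - N + 1, ?_⟩
    push_cast [Nat.cast_sub (show c ≤ ν + t - 1 by omega), Nat.cast_sub (show 1 ≤ ν + t by omega)]
    ring

theorem exists_eq_runnerStart_add (t ν N : ℕ) {c : ℕ} (hν : ν < t) (hc : c < t) {b : ℕ}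
    (h : ((t * N + ν : ℕ) : ℤ) - 1 - b ≡ c [ZMOD t]) : ∃ a, b = t * a + runnerStart t ν c := by
  have h1 := h.trans (modEq_runnerStart_add t ν N hν hc 0).symm
  have h2 : (runnerStart t ν c : ℤ) ≡ b [ZMOD t] := by
    have := (Int.ModEq.refl (((t * N + ν : ℕ) : ℤ) - 1)).sub h1
    simpa using this.symm
  have hs : runnerStart t ν c < t := by
    rw [runnerStart]; split_ifs <;> omega
  have h3 := Int.natCast_modEq_iff.1 h2
  rw [Nat.ModEq, Nat.mod_eq_of_lt hs] at h3
  exact ⟨b / t, by rw [h3, Nat.div_add_mod]⟩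

theorem eq_of_modEq_of_lt {t c d : ℕ} (hc : c < t) (hd : d < t) {x : ℤ} (h : x ≡ c [ZMOD t])
    (h' : x ≡ d [ZMOD t]) : c = d :=
  (Int.natCast_modEq_iff.1 (h.symm.trans h')).eq_of_lt_of_lt hc hd

theorem exists_modEq_lt {t : ℕ} (ht : 0 < t) (x : ℤ) : ∃ c < t, x ≡ (c : ℕ) [ZMOD t] := by
  have h0 := Int.emod_nonneg x (show (t : ℤ) ≠ 0 by omega)
  have h1 := Int.emod_lt_of_pos x (show (0 : ℤ) < t by omega)
  exact ⟨(x % t).toNat, by omega, by rw [Int.toNat_of_nonneg h0]; exact (Int.mod_modEq x t).symm⟩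

/-- The set of positions of beads given by sets of beads on each of the `t` runners. -/
def joinRunners (t ν : ℕ) (T : Fin t → Finset ℕ) : Finset ℕ :=
  Finset.univ.biUnion fun c => (T c).image fun a => t * a + runnerStart t ν c

theorem filter_joinRunners {t ν : ℕ} (N : ℕ) (hν : ν < t) (T : Fin t → Finset ℕ) (c : Fin t) :
    ((joinRunners t ν T).filter fun b : ℕ => ((t * N + ν : ℕ) : ℤ) - 1 - b ≡ (c : ℕ) [ZMOD t]) =
      (T c).image fun a => t * a + runnerStart t ν c := by
  ext b
  simp only [joinRunners, Finset.mem_filter, Finset.mem_biUnion, Finset.mem_univ, true_and,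
    Finset.mem_image]
  constructor
  · rintro ⟨⟨d, a, ha, rfl⟩, h⟩
    obtain rfl : d = c := Fin.ext
      (eq_of_modEq_of_lt d.2 c.2 (modEq_runnerStart_add t ν N hν d.2 a) h)
    exact ⟨a, ha, rfl⟩
  · rintro ⟨a, ha, rfl⟩
    exact ⟨⟨c, a, ha, rfl⟩, modEq_runnerStart_add t ν N hν c.2 a⟩

theorem runner_injective {t : ℕ} (ht : 0 < t) (s : ℕ) : Function.Injective fun a => t * a + s := by
  intro a b h
  exact Nat.eq_of_mul_eq_mul_left ht (Nat.add_right_cancel h)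

theorem card_filter_joinRunners {t ν : ℕ} (N : ℕ) (hν : ν < t) (T : Fin t → Finset ℕ) (c : Fin t) :
    ((joinRunners t ν T).filter
      fun b : ℕ => ((t * N + ν : ℕ) : ℤ) - 1 - b ≡ (c : ℕ) [ZMOD t]).card = (T c).card := by
  rw [filter_joinRunners N hν,
    Finset.card_image_of_injective _ (runner_injective (Nat.zero_lt_of_lt hν) _)]

theorem joinRunners_injective {t ν : ℕ} (hν : ν < t) : Function.Injective (joinRunners t ν) := by
  intro S T h
  funext c
  apply Finset.image_injective (runner_injective (Nat.zero_lt_of_lt hν) (runnerStart t ν c))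
  rw [← filter_joinRunners 0 hν, ← filter_joinRunners 0 hν, h]

theorem joinRunners_surjective {t ν : ℕ} (hν : ν < t) : Function.Surjective (joinRunners t ν) := by
  intro S
  have hinj := fun c => runner_injective (Nat.zero_lt_of_lt hν) (runnerStart t ν c)
  refine ⟨fun c => S.preimage (fun a => t * a + runnerStart t ν c) (hinj c).injOn, ?_⟩
  ext b
  simp only [joinRunners, Finset.mem_biUnion, Finset.mem_univ, true_and, Finset.mem_image,
    Finset.mem_preimage]
  constructor
  · rintro ⟨c, a, ha, rfl⟩
    exact ha
  · intro hb
    obtain ⟨c, hc, h⟩ := exists_modEq_lt (Nat.zero_lt_of_lt hν) (((t * 0 + ν : ℕ) : ℤ) - 1 - b)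
    obtain ⟨a, rfl⟩ := exists_eq_runnerStart_add t ν 0 hν hc h
    exact ⟨⟨c, hc⟩, a, hb, rfl⟩

theorem sum_joinRunners {A : Type*} [AddCommMonoid A] {t ν : ℕ} (hν : ν < t)
    (T : Fin t → Finset ℕ) (f : ℕ → A) :
    ∑ b ∈ joinRunners t ν T, f b = ∑ c, ∑ a ∈ T c, f (t * a + runnerStart t ν c) := by
  rw [joinRunners, Finset.sum_biUnion]
  · refine Finset.sum_congr rfl fun c _ => Finset.sum_image fun a _ b _ h => ?_
    exact runner_injective (Nat.zero_lt_of_lt hν) _ h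
  · intro c _ d _ hcd
    rw [Function.onFun, Finset.disjoint_left]
    intro b hb hb'
    obtain ⟨a, _, rfl⟩ := Finset.mem_image.1 hb
    obtain ⟨a', _, h⟩ := Finset.mem_image.1 hb'
    have h1 := modEq_runnerStart_add t ν 0 hν c.2 a
    have h2 := modEq_runnerStart_add t ν 0 hν d.2 a'
    rw [h] at h2
    exact hcd (Fin.ext (eq_of_modEq_of_lt c.2 d.2 h1 h2))

@[to_additive]
theorem prod_range_eq_first_mul_last {A : Type*} [CommMonoid A] {t : ℕ} (ht : 2 ≤ t) (f : ℕ → A) :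
    ∏ c ∈ Finset.range t, f c = f 0 * (∏ c ∈ Finset.Icc 1 (t - 2), f c) * f (t - 1) := by
  obtain ⟨t, rfl⟩ := Nat.exists_eq_add_of_le' ht
  rw [Finset.prod_range_succ, Finset.prod_range_succ', mul_comm _ (f 0)]
  congr 2
  rw [Nat.add_sub_cancel, Finset.range_eq_Ico, Finset.prod_Ico_add' f 0 t 1]
  rfl

theorem two_mul_sum_range (n : ℕ) : 2 * ((∑ i ∈ Finset.range n, i : ℕ) : ℤ) = n * (n - 1) := by
  induction n with
  | zero => simp
  | succ n ih =>
    rw [Finset.sum_range_succ]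
    push_cast at ih ⊢
    linarith

theorem two_mul_sum_range_linear (n : ℕ) (a b : ℤ) :
    ∑ i ∈ Finset.range n, (a + 2 * b * i) = n * a + b * (n * (n - 1)) := by
  rw [← two_mul_sum_range, Finset.sum_add_distrib, ← Finset.mul_sum]
  push_cast
  simp
  ring

theorem sum_base_weight {t ν : ℕ} (N : ℕ) (hν : ν < t) :
    ∑ c ∈ Finset.range t, ((t : ℤ) * (baseSize N ν c * (baseSize N ν c - 1)) +
      2 * runnerStart t ν c * baseSize N ν c) =
      ((t * N + ν : ℕ) : ℤ) * ((t * N + ν : ℕ) - 1) := by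
  obtain ⟨r, rfl⟩ := Nat.exists_eq_add_of_lt hν
  rw [add_assoc, Finset.sum_range_add]
  have h1 : ∀ c ∈ Finset.range ν, (((ν + (r + 1) : ℕ) : ℤ) * (baseSize N ν c *
      (baseSize N ν c - 1)) + 2 * runnerStart (ν + (r + 1)) ν c * baseSize N ν c) =
      ((ν + r + 1) * ((N + 1) * N) + 2 * (ν - 1) * (N + 1)) + 2 * (-(N + 1)) * c := by
    intro c hc
    have := Finset.mem_range.1 hc
    rw [baseSize, runnerStart, if_pos this, if_pos this]
    push_cast [Nat.cast_sub (show c ≤ ν - 1 by omega), Nat.cast_sub (show 1 ≤ ν by omega)]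
    ring
  have h2 : ∀ c ∈ Finset.range (r + 1), (((ν + (r + 1) : ℕ) : ℤ) * (baseSize N ν (ν + c) *
      (baseSize N ν (ν + c) - 1)) +
      2 * runnerStart (ν + (r + 1)) ν (ν + c) * baseSize N ν (ν + c)) =
      ((ν + r + 1) * (N * (N - 1)) + 2 * (ν + r) * N) + 2 * (-N) * c := by
    intro c hc
    have := Finset.mem_range.1 hc
    rw [baseSize, runnerStart, if_neg (by omega), if_neg (by omega),
      show ν + (ν + (r + 1)) - 1 - (ν + c) = ν + r - c by omega]
    push_cast [Nat.cast_sub (show c ≤ ν + r by omega)]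
    ring
  rw [Finset.sum_congr rfl h1, Finset.sum_congr rfl h2, two_mul_sum_range_linear,
    two_mul_sum_range_linear]
  push_cast
  ring

theorem sum_runner_weight {t ν : ℕ} (N : ℕ) (ht : 2 ≤ t) (hν : ν < t) (k : ℤ) (m : ℕ → ℕ)
    (hm : ∀ c < t, (m c : ℤ) = runnerSize t N ν k c) :
    ∑ c ∈ Finset.range t, (t * ∑ i ∈ Finset.range (m c), i + runnerStart t ν c * m c) =
      (∑ i ∈ Finset.range (t * N + ν), i) + ((t : ℤ) * k ^ 2 - ((t : ℤ) - 1) * k).toNat := by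
  have hs : ∀ c < t, (runnerStart t ν c : ℤ) + t * baseSize N ν c = (t * N + ν) - 1 - c + t := by
    intro c hc
    rw [runnerStart, baseSize]
    split_ifs
    · push_cast [Nat.cast_sub (show c ≤ ν - 1 by omega), Nat.cast_sub (show 1 ≤ ν by omega)]
      ring
    · push_cast [Nat.cast_sub (show c ≤ ν + t - 1 by omega),
        Nat.cast_sub (show 1 ≤ ν + t by omega)]
      ring
  let d : ℕ → ℤ := fun c => (if c = t - 1 then k else 0) - if c = 0 then k else 0
  let F : ℕ → ℤ := fun c => 2 * d c * ((t * N + ν) - 1 - c + t) + t * (d c * (d c - 1))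
  have hdiff : ∀ c ∈ Finset.range t,
      2 * ((t * ∑ i ∈ Finset.range (m c), i + runnerStart t ν c * m c : ℕ) : ℤ) =
      ((t : ℤ) * (baseSize N ν c * (baseSize N ν c - 1)) +
        2 * runnerStart t ν c * baseSize N ν c) + F c := by
    intro c hc
    have hc := Finset.mem_range.1 hc
    have h1 := two_mul_sum_range (m c)
    rw [hm c hc, runnerSize] at h1
    rw [Nat.cast_add, Nat.cast_mul, Nat.cast_mul, hm c hc, runnerSize]
    simp only [F, d]
    rw [← hs c hc]
    linear_combination (t : ℤ) * h1
  have hF : ∑ c ∈ Finset.range t, F c = 2 * (t * k ^ 2 - (t - 1) * k) := by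
    have h1 : t - 1 ≠ 0 := by omega
    rw [sum_range_eq_first_add_last ht, Finset.sum_eq_zero (s := Finset.Icc 1 (t - 2))]
    · simp only [F, d, h1, h1.symm, if_true, if_false]
      push_cast [Nat.cast_sub (show 1 ≤ t by omega)]
      ring
    · intro c hc
      have := Finset.mem_Icc.1 hc
      simp only [F, d]
      rw [if_neg (by omega), if_neg (by omega)]
      simp
  zify
  rw [Int.toNat_of_nonneg (exponent_nonneg t (by omega) k)]
  refine mul_left_cancel₀ (two_ne_zero (α := ℤ)) ?_
  have hsum := Finset.sum_congr rfl hdiff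
  rw [← Finset.mul_sum, Finset.sum_add_distrib, sum_base_weight N hν, hF] at hsum
  have h2 := two_mul_sum_range (t * N + ν)
  push_cast at hsum h2 ⊢
  linear_combination hsum - h2

theorem card_eq_sum_card_filter_modEq {t : ℕ} (ht : 0 < t) (S : Finset ℕ) (x : ℕ → ℤ) :
    S.card = ∑ c ∈ Finset.range t, (S.filter fun b => x b ≡ (c : ℕ) [ZMOD t]).card := by
  simp only [Finset.card_filter]
  rw [Finset.sum_comm, Finset.card_eq_sum_ones]
  refine Finset.sum_congr rfl fun b _ => ?_
  obtain ⟨c, hc, h⟩ := exists_modEq_lt ht (x b)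
  rw [Finset.sum_eq_single_of_mem c (Finset.mem_range.2 hc), if_pos h]
  intro d hd hdc
  rw [if_neg fun h' => hdc (eq_of_modEq_of_lt (Finset.mem_range.1 hd) hc h' h)]

theorem sum_runnerSize {t ν : ℕ} (N : ℕ) (ht : 2 ≤ t) (hν : ν < t) (k : ℤ) :
    ∑ c ∈ Finset.range t, runnerSize t N ν k c = t * N + ν := by
  have h := card_eq_sum_card_filter_modEq (t := t) (by omega) (Finset.range (t * N + ν)) fun j => (j : ℤ)
  rw [Finset.card_range, Finset.sum_congr rfl fun c hc =>
    card_range_filter_modEq (t := t) N hν (Finset.mem_range.1 hc)] at h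
  simp only [runnerSize]
  rw [Finset.sum_add_distrib, Finset.sum_sub_distrib, Finset.sum_ite_eq' _ (t - 1),
    Finset.sum_ite_eq' _ 0, if_pos (Finset.mem_range.2 (by omega)),
    if_pos (Finset.mem_range.2 (by omega)), sub_self, add_zero]
  exact_mod_cast h.symm

/-- Partitions of `n` with bounded largest part and GBG-rank `k` correspond to the sets of beads on
the runners with the prescribed numbers of elements and the prescribed weight. -/
theorem card_partition_eq_card_runners {t ν : ℕ} (N n : ℕ) (ht : t.Prime) (hν : ν < t) (k : ℤ)
    (m : ℕ → ℕ) (hm : ∀ c < t, (m c : ℤ) = runnerSize t N ν k c) :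
    Nat.card {p : n.Partition // gbgRank p t = (k : ℂ) ∧ largestPart p ≤ t * N + ν} =
      Nat.card {T : (c : Fin t) → {T : Finset ℕ // T.card = m c} //
        ∑ c : Fin t, (t * ∑ b ∈ (T c).1, b + runnerStart t ν c * m c) =
          n + ∑ i ∈ Finset.range (t * N + ν), i} := by
  have hsum : ∀ T : Fin t → Finset ℕ, (∀ c : Fin t, (T c).card = m c) →
      ∑ b ∈ joinRunners t ν T, b =
        ∑ c : Fin t, (t * ∑ b ∈ T c, b + runnerStart t ν c * m c) := by
    intro T hT
    rw [sum_joinRunners hν T fun b => b]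
    refine Finset.sum_congr rfl fun c _ => ?_
    rw [Finset.sum_add_distrib, Finset.mul_sum, Finset.sum_const, hT c, smul_eq_mul, mul_comm (m c)]
  let D := {S : Finset ℕ // (∀ c : Fin t, (S.filter
    fun b : ℕ => ((t * N + ν : ℕ) : ℤ) - 1 - b ≡ (c : ℕ) [ZMOD t]).card = m c) ∧
      ∑ b ∈ S, b = n + ∑ i ∈ Finset.range (t * N + ν), i}
  have hcount : ∀ p : n.Partition, largestPart p ≤ t * N + ν →
      (gbgRank p t = (k : ℂ) ↔ ∀ c : Fin t, ((betaSet (t * N + ν) (youngDiagram p)).filter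
        fun b : ℕ => ((t * N + ν : ℕ) : ℤ) - 1 - b ≡ (c : ℕ) [ZMOD t]).card = m c) := by
    intro p hp
    rw [gbgRank_eq_iff_card_filter_betaSet p N ht hν k hp]
    refine ⟨fun h c => ?_, fun h c hc => ?_⟩
    · have := h c c.2
      rw [← hm c c.2] at this
      exact_mod_cast this
    · rw [← hm c hc]
      exact_mod_cast h ⟨c, hc⟩
  let f : {p : n.Partition // gbgRank p t = (k : ℂ) ∧ largestPart p ≤ t * N + ν} → D := fun p =>
    ⟨betaSet (t * N + ν) (youngDiagram p.1), (hcount p.1 p.2.2).1 p.2.1, by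
      rw [sum_betaSet ((largestPart_le_iff _ _).1 p.2.2), card_youngDiagram]⟩
  have hf : Function.Bijective f := by
    constructor
    · intro p q h
      exact Subtype.ext (youngDiagram_injective (betaSet_injOn _ ((largestPart_le_iff _ _).1 p.2.2)
        ((largestPart_le_iff _ _).1 q.2.2) (congrArg Subtype.val h)))
    · rintro ⟨S, hS, hSsum⟩
      have hcard : S.card = t * N + ν := by
        rw [card_eq_sum_card_filter_modEq ht.pos S fun b => ((t * N + ν : ℕ) : ℤ) - 1 - b]
        zify
        rw [Finset.sum_congr rfl fun c hc => (congrArg Nat.cast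
          (hS ⟨c, Finset.mem_range.1 hc⟩)).trans (hm c (Finset.mem_range.1 hc)),
          sum_runnerSize N ht.two_le hν]
      obtain ⟨μ, hμ, hβ⟩ := exists_betaSet_eq S
      rw [hcard] at hμ hβ
      have hn : μ.card = n := by
        have := sum_betaSet hμ
        rw [hβ, hSsum] at this
        omega
      subst hn
      obtain ⟨p, hp⟩ := exists_youngDiagram_eq μ
      have hpM : largestPart p ≤ t * N + ν := by rw [largestPart_le_iff, hp, hμ]
      refine ⟨⟨p, (hcount p hpM).2 (by rw [hp, hβ]; exact hS), hpM⟩, Subtype.ext ?_⟩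
      change betaSet _ (youngDiagram p) = S
      rw [hp, hβ]
  let g : {T : (c : Fin t) → {T : Finset ℕ // T.card = m c} //
      ∑ c : Fin t, (t * ∑ b ∈ (T c).1, b + runnerStart t ν c * m c) =
        n + ∑ i ∈ Finset.range (t * N + ν), i} → D := fun T =>
    ⟨joinRunners t ν fun c => (T.1 c).1,
      fun c => by rw [card_filter_joinRunners N hν, (T.1 c).2],
      by rw [hsum _ fun c => (T.1 c).2, T.2]⟩
  have hg : Function.Bijective g := by
    constructor
    · intro S T h
      have h1 := joinRunners_injective hν (congrArg Subtype.val h)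
      exact Subtype.ext (funext fun c => Subtype.ext (congrFun h1 c))
    · rintro ⟨S, hS, hSsum⟩
      obtain ⟨T, rfl⟩ := joinRunners_surjective hν S
      have hT : ∀ c : Fin t, (T c).card = m c := fun c => by
        rw [← hS c, card_filter_joinRunners N hν]
      exact ⟨⟨fun c => ⟨T c, hT c⟩, by rw [← hSsum, hsum T hT]⟩, rfl⟩
  rw [Nat.card_eq_of_bijective f hf, Nat.card_eq_of_bijective g hg]

theorem genGBG_eq_zero {t ν : ℕ} (N : ℕ) (ht : t.Prime) (hν : ν < t) (k : ℤ) {c : ℕ} (hc : c < t)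
    (h : runnerSize t N ν k c < 0) : genGBG (t * N + ν) t k = 0 := by
  ext n
  rw [genGBG, PowerSeries.coeff_mk]
  have : IsEmpty {p : n.Partition // gbgRank p t = (k : ℂ) ∧ largestPart p ≤ t * N + ν} := by
    refine ⟨fun p => ?_⟩
    have := (gbgRank_eq_iff_card_filter_betaSet p.1 N ht hν k p.2.2).1 p.2.1 c hc
    omega
  simp

theorem genGBG_eq_prod {t ν : ℕ} (N : ℕ) (ht : t.Prime) (hν : ν < t) (k : ℤ) :
    genGBG (t * N + ν) t k =
      PowerSeries.X ^ ((t : ℤ) * k ^ 2 - ((t : ℤ) - 1) * k).toNat *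
        ∏ c ∈ Finset.range t, recipPoch t (runnerSize t N ν k c) := by
  by_cases hneg : ∃ c < t, runnerSize t N ν k c < 0
  · obtain ⟨c, hc, h⟩ := hneg
    rw [genGBG_eq_zero N ht hν k hc h, Finset.prod_eq_zero (Finset.mem_range.2 hc), mul_zero]
    rw [recipPoch, if_pos h]
  · push Not at hneg
    let m : ℕ → ℕ := fun c => (runnerSize t N ν k c).toNat
    have hm : ∀ c < t, (m c : ℤ) = runnerSize t N ν k c := fun c hc =>
      Int.toNat_of_nonneg (hneg c hc)
    have hfin : ∀ (c : Fin t) (n : ℕ), Finite {T : {T : Finset ℕ // T.card = m c} //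
        t * ∑ b ∈ T.1, b + runnerStart t ν c * m c = n} := by
      intro c n
      have := finite_finset_weight ht.pos (m c) (n - runnerStart t ν c * m c)
      exact Finite.of_injective (fun T => (⟨T.1, by have := T.2; omega⟩ :
        {T : {T : Finset ℕ // T.card = m c} // t * ∑ b ∈ T.1, b = n - runnerStart t ν c * m c}))
        fun S T h => Subtype.ext (congrArg (fun x => x.1) h)
    have hpi := weightGF_pi (fun (c : Fin t) (T : {T : Finset ℕ // T.card = m c}) =>
      t * ∑ b ∈ T.1, b + runnerStart t ν c * m c) hfin
    simp only [weightGF_add_const, weightGF_finset ht.pos] at hpi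
    rw [Fin.prod_univ_eq_prod_range (fun c => PowerSeries.X ^ (t * ∑ i ∈ Finset.range (m c), i) *
      recipPoch t (m c) * PowerSeries.X ^ (runnerStart t ν c * m c)) t] at hpi
    have hprod : ∏ c ∈ Finset.range t, (PowerSeries.X ^ (t * ∑ i ∈ Finset.range (m c), i) *
        recipPoch t (m c) * PowerSeries.X ^ (runnerStart t ν c * m c) : ℚ⟦X⟧) =
        (PowerSeries.X ^ ((t : ℤ) * k ^ 2 - ((t : ℤ) - 1) * k).toNat *
          ∏ c ∈ Finset.range t, recipPoch t (runnerSize t N ν k c)) *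
          PowerSeries.X ^ (∑ i ∈ Finset.range (t * N + ν), i) := by
      rw [mul_right_comm, ← pow_add, add_comm _ (∑ i ∈ Finset.range (t * N + ν), i),
        ← sum_runner_weight N ht.two_le hν k m hm, ← Finset.prod_pow_eq_pow_sum,
        ← Finset.prod_mul_distrib]
      refine Finset.prod_congr rfl fun c hc => ?_
      rw [← hm c (Finset.mem_range.1 hc), pow_add, mul_right_comm]
    ext n
    rw [genGBG, PowerSeries.coeff_mk, card_partition_eq_card_runners N n ht hν k m hm,
      ← coeff_weightGF, hpi, hprod, PowerSeries.coeff_mul_X_pow]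

theorem baseSize_eq_ceil {t ν c : ℕ} (N : ℕ) (hν : ν < t) (hc : c < t) :
    (baseSize N ν c : ℤ) = N + ⌈((ν : ℚ) - (c : ℚ)) / (t : ℚ)⌉ := by
  have ht : (0 : ℚ) < t := by exact_mod_cast Nat.zero_lt_of_lt hc
  have hν' : (ν : ℚ) < t := by exact_mod_cast hν
  have hc' : (c : ℚ) < t := by exact_mod_cast hc
  rw [baseSize]
  split_ifs with h
  · have h' : (c : ℚ) < ν := by exact_mod_cast h
    rw [Int.ceil_eq_iff (z := 1) |>.2]
    · push_cast; rfl
    · constructor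
      · push_cast; rw [sub_self]; exact div_pos (by linarith) ht
      · push_cast; rw [div_le_one ht]; have : (0 : ℚ) ≤ c := Nat.cast_nonneg c; linarith
  · have h' : (ν : ℚ) ≤ c := by exact_mod_cast not_lt.1 h
    rw [Int.ceil_eq_iff (z := 0) |>.2]
    · simp
    · constructor
      · push_cast; rw [lt_div_iff₀ ht]; have : (0 : ℚ) ≤ ν := Nat.cast_nonneg ν; linarith
      · push_cast; exact div_nonpos_of_nonpos_of_nonneg (by linarith) ht.le

theorem genGBG_eq {t ν : ℕ} (N : ℕ) (ht : t.Prime) (hν : ν < t) (k : ℤ) :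
    genGBG (t * N + ν) t k =
      PowerSeries.X ^ ((t : ℤ) * k ^ 2 - ((t : ℤ) - 1) * k).toNat *
        (recipPoch t ((N : ℤ) + ⌈(ν : ℚ) / (t : ℚ)⌉ - k) *
          (∏ i ∈ Finset.Icc 1 (t - 2),
            recipPoch t ((N : ℤ) + ⌈((ν : ℚ) - (i : ℚ)) / (t : ℚ)⌉)) *
          recipPoch t ((N : ℤ) + k)) := by
  have h2 := ht.two_le
  rw [genGBG_eq_prod N ht hν, prod_range_eq_first_mul_last h2]
  congr 3
  · rw [runnerSize, if_neg (by omega), if_pos rfl, baseSize_eq_ceil N hν ht.pos, Nat.cast_zero,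
      sub_zero]
    congr 1
    ring
  · refine Finset.prod_congr rfl fun c hc => ?_
    have := Finset.mem_Icc.1 hc
    rw [runnerSize, if_neg (by omega), if_neg (by omega), baseSize_eq_ceil N hν (by omega)]
    simp
  · rw [runnerSize, if_pos rfl, if_neg (by omega), baseSize, if_neg (by omega), sub_zero]

theorem genBG_eq_genGBG (M : ℕ) (k : ℤ) : genBG M k = genGBG M 2 k := by
  ext n
  simp only [genBG, genGBG, PowerSeries.coeff_mk, gbgRank_two_eq_iff]

theorem genBG_eq {ν : ℕ} (N : ℕ) (hν : ν ≤ 1) (k : ℤ) :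
    genBG (2 * N + ν) k =
      PowerSeries.X ^ (2 * k ^ 2 - k).toNat *
        (recipPoch 2 ((N : ℤ) + k) * recipPoch 2 ((N : ℤ) + (ν : ℤ) - k)) := by
  have h : ⌈(ν : ℚ) / ((2 : ℕ) : ℚ)⌉ = (ν : ℤ) := by
    interval_cases ν
    · simp
    · rw [Int.ceil_eq_iff]; norm_num
  rw [genBG_eq_genGBG, genGBG_eq N Nat.prime_two (by omega), h]
  simp only [Nat.sub_self, Finset.Icc_eq_empty_of_lt Nat.zero_lt_one, Finset.prod_empty, mul_one]
  rw [mul_comm (recipPoch 2 ((N : ℤ) + k))]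
  congr 4
  push_cast
  ring

end GBG

theorem theorem2p1 (N : ℕ) (k : ℤ) :
    (∀ t : ℕ, t.Prime → ∀ ν : ℕ, ν ≤ t - 1 →
      GBG.genGBG (t * N + ν) t k =
        PowerSeries.X ^ ((t : ℤ) * k ^ 2 - ((t : ℤ) - 1) * k).toNat *
          (GBG.recipPoch t ((N : ℤ) + ⌈(ν : ℚ) / (t : ℚ)⌉ - k) *
            (∏ i ∈ Finset.Icc 1 (t - 2),
              GBG.recipPoch t ((N : ℤ) + ⌈((ν : ℚ) - (i : ℚ)) / (t : ℚ)⌉)) *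
            GBG.recipPoch t ((N : ℤ) + k))) ∧
    (∀ ν : ℕ, ν ≤ 1 →
      GBG.genBG (2 * N + ν) k =
        PowerSeries.X ^ (2 * k ^ 2 - k).toNat *
          (GBG.recipPoch 2 ((N : ℤ) + k) * GBG.recipPoch 2 ((N : ℤ) + (ν : ℤ) - k))) :=
  ⟨fun _ ht _ hν => GBG.genGBG_eq N ht (by have := ht.pos; omega) k,
    fun _ hν => GBG.genBG_eq N hν k⟩
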